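/- **Setting.** Fix $d\ge 0$. A (locally finite) cell complex $K$ in $\mathbb R^d$ is a collection of subsets (closed cells) of $\mathbb R^d$, each homeomorphic to a closed unit ball of some dimension $p\le d$, such that the boundary of each cell is a union of lower-dimensional cells of $K$ (its faces), any two cells intersect in a (possibly empty) union of common faces (a cell counting as a face of itself), and every point of $\mathbb R^d$ has a neighborhood meeting only finitely many cells. A filter on $K$ is a function $f\colon K\to\mathbb R$ with $f(\sigma)\le f(\tau)$ whenever $\sigma$ is a face of $\tau$; write $K_t$ for the union of the cells with $f\le t$. Given a full-dimensional lattice $\Lambda\subseteq\mathbb R^d$, $K$ and $f$ are $\Lambda$-periodic if $\sigma+u\in K$ and $f(\sigma+u)=f(\sigma)$ for all $\sigma\in K$, $u\in\Lambda$. **Periodic merge tree.** Let $\phi\colon\mathbb R^d\to\mathbb R^d/\Lambda$ be the projection and $(K/\Lambda)_t=\phi(K_t)$. The periodic merge tree $M(f,\Lambda)$ is the quotient of $\{(x,s)\in(\mathbb R^d/\Lambda)\times\mathbb R : x\in(K/\Lambda)_s\}$ that identifies $(x,s)$ and $(y,s)$ when $x,y$ lie in the same connected component of $(K/\Lambda)_s$,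 with the quotient topology. Its points are thus connected components $\Gamma$ of sublevel sets; the height $h(\Gamma)$ is the corresponding $s$; and $B$ covers $A$ if $h(A)\le h(B)$ and $A\subseteq B$. The shadows of $\Gamma$ are the connected components of $\phi^{-1}(\Gamma)$, and $\Lambda_\Gamma=\{u\in\Lambda : c+u=c \text{ for every shadow } c \text{ of } \Gamma\}$. The frequency of $\Gamma$ is the monomial $$F(\Gamma)=\frac{\mathrm{vol}_p(\Lambda_\Gamma)}{\mathrm{vol}_d(\Lambda)}\,\nu_{d-p}\,R^{d-p},\qquad p=\dim\Lambda_\Gamma,$$ where $\mathrm{vol}_p$ is the $p$-dimensional volume of a unit cell of the lattice and $\nu_q$ is the volume of the unit ball in $\mathbb R^q$. Monomials are ordered by exponent first and then by coefficient. A *periodic merge tree* is any $M(f,\Lambda)$ with its height and frequency functions, for some $K$, $\Lambda$, $f$ as above in $\mathbb R^d$. **Interleaving distance.** For $\varepsilon\ge0$, continuous maps $\varphi\colon M\to M'$, $\psi\colon M'\to M$ between periodic merge trees (or subtrees of them) are $\varepsilon$-compatible if both raise heights by exactly $\varepsilon$, $\psi\varphi(\Gamma)$ covers $\Gamma$ and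 $\varphi\psi(\Gamma')$ covers $\Gamma'$, and $F'(\varphi(\Gamma))\le F(\Gamma)$, $F(\psi(\Gamma'))\le F'(\Gamma')$, for all $\Gamma\in M,\Gamma'\in M'$. The interleaving distance $D(M,M')\in[0,\infty]$ is the infimum of the $\varepsilon\ge 0$ for which $\varepsilon$-compatible maps exist ($\inf\emptyset=\infty$). **Splintering.** Write $M_\Gamma$ for the subtree of points covered by $\Gamma$. We say $M'$ splinters $M$ if there is a continuous, height-preserving surjection $\omega\colon M'\to M$ such that for every $\Gamma\in M$ the fiber $\omega^{-1}(\Gamma)$ is finite and for all $A,B\in\omega^{-1}(\Gamma)$: $D(M'_A,M'_B)=0$; $\omega(M'_A)=\omega(M'_B)=M_\Gamma$; and $F'(A)=F'(B)=F(\Gamma)/\#\omega^{-1}(\Gamma)$. Periodic merge trees $M,N$ are equivalent, $M\simeq N$, if some periodic merge tree splinters both; $[M]$ is the class of periodic merge trees equivalent to $M$. The interleaving pseudo-distance is $$J([M],[M'])=\inf\Big\{\sum_{i=1}^k D(M_i,M_i') : k\ge1,\ M_1\in[M],\ M_k'\in[M'],\ M_i'\simeq M_{i+1}\ (1\le i<k)\Big\}.$$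 **Theorem (Invariance of equivalence classes of periodic merge trees).** Let $\Lambda\subseteq\mathbb R^d$ be a $d$-dimensional lattice, $K$ a locally finite $\Lambda$-periodic cell complex in $\mathbb R^d$, $f\colon K\to\mathbb R$ a $\Lambda$-periodic filter, and $\Lambda',\Lambda''\subseteq\Lambda$ two $d$-dimensional sublattices. Then $M(f,\Lambda')\simeq M(f,\Lambda'')$, and $$J\big([M(f,\Lambda')],[M(f,\Lambda'')]\big)=0.$$ -/

import Mathlib

open scoped NNReal ENNReal Pointwise

noncomputable section

namespace PeriodicMerge

/-! ### Cell complexes and filters -/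

/-- A locally finite cell complex in `ℝ^d`: a collection of subsets of `ℝ^d` (the closed cells),
each with its dimension and its boundary. A cell of dimension `p` is homeomorphic to the closed unit
ball of `ℝ^p`, its boundary being the image of the unit sphere. -/
structure CellComplex (d : ℕ) where
  /-- the closed cells -/
  cells : Set (Set (EuclideanSpace ℝ (Fin d)))
  /-- the dimension of a cell -/
  dim : cells → ℕ
  /-- the boundary of a cell -/
  bd : cells → Set (EuclideanSpace ℝ (Fin d))
  dim_le : ∀ σ, dim σ ≤ d
  exists_homeomorph : ∀ σ : cells,
    ∃ h : Metric.closedBall (0 : EuclideanSpace ℝ (Fin (dim σ))) 1 ≃ₜ σ.1,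
      bd σ = (fun x => (h x : EuclideanSpace ℝ (Fin d))) ''
        {x | (x : EuclideanSpace ℝ (Fin (dim σ))) ∈ Metric.sphere 0 1}
  /-- the boundary of a cell is a union of lower-dimensional cells of the complex -/
  bd_eq : ∀ σ : cells,
    bd σ = ⋃ ρ ∈ {ρ : cells | dim ρ < dim σ ∧ ρ.1 ⊆ bd σ}, ρ.1
  /-- two cells intersect in a (possibly empty) union of common faces; a cell counts here as a face
  of itself -/
  inter_eq : ∀ σ τ : cells, σ.1 ∩ τ.1 =
    ⋃ ρ ∈ {ρ : cells |
      (ρ = σ ∨ (dim ρ < dim σ ∧ ρ.1 ⊆ bd σ)) ∧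
      (ρ = τ ∨ (dim ρ < dim τ ∧ ρ.1 ⊆ bd τ))}, ρ.1
  locallyFinite : LocallyFinite (fun σ : cells => σ.1)

variable {d : ℕ}

/-- `ρ` is a (proper) face of `σ`. -/
def CellComplex.IsFace (K : CellComplex d) (ρ σ : K.cells) : Prop :=
  K.dim ρ < K.dim σ ∧ ρ.1 ⊆ K.bd σ

/-- A filter on `K`: a real function on the cells that does not decrease from a face to a cell. -/
def CellComplex.IsFilter (K : CellComplex d) (f : K.cells → ℝ) : Prop :=
  ∀ σ τ : K.cells, K.IsFace σ τ → f σ ≤ f τ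

/-- The sublevel set `K_t`, as a set of points: the union of the cells of value at most `t`. -/
def CellComplex.sublevel (K : CellComplex d) (f : K.cells → ℝ) (t : ℝ) :
    Set (EuclideanSpace ℝ (Fin d)) :=
  ⋃ σ ∈ {σ : K.cells | f σ ≤ t}, σ.1

/-- `K` is periodic with respect to `Λ`: translates of cells by vectors of `Λ` are cells. -/
def CellComplex.IsPeriodic (K : CellComplex d)
    (Λ : Submodule ℤ (EuclideanSpace ℝ (Fin d))) : Prop :=
  ∀ σ ∈ K.cells, ∀ u ∈ Λ, u +ᵥ σ ∈ K.cells

/-- `f` takes the same value on cells of `K` that are translates of each other by vectors of `Λ`. -/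
def CellComplex.IsPeriodicFun (K : CellComplex d) (f : K.cells → ℝ)
    (Λ : Submodule ℤ (EuclideanSpace ℝ (Fin d))) : Prop :=
  ∀ σ τ : K.cells, ∀ u ∈ Λ, τ.1 = u +ᵥ σ.1 → f τ = f σ

/-- `f` is a `Λ`-periodic filter on the `Λ`-periodic complex `K`. -/
structure CellComplex.IsPeriodicFilter (K : CellComplex d) (f : K.cells → ℝ)
    (Λ : Submodule ℤ (EuclideanSpace ℝ (Fin d))) : Prop where
  isFilter : K.IsFilter f
  isPeriodic : K.IsPeriodic Λ
  isPeriodicFun : K.IsPeriodicFun f Λ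

theorem CellComplex.IsPeriodicFilter.mono {K : CellComplex d} {f : K.cells → ℝ}
    {Λ Λ' : Submodule ℤ (EuclideanSpace ℝ (Fin d))} (h : K.IsPeriodicFilter f Λ) (hle : Λ' ≤ Λ) :
    K.IsPeriodicFilter f Λ' :=
  ⟨h.isFilter, fun σ hσ u hu => h.isPeriodic σ hσ u (hle hu),
    fun σ τ u hu => h.isPeriodicFun σ τ u (hle hu)⟩

/-- The sublevel set `(K/Λ)_t` of the quotient filter `f/Λ`, as a set of points of the torus
`ℝ^d/Λ`: the union of the images of the cells of value at most `t`. -/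
def CellComplex.quotientSublevel (K : CellComplex d) (f : K.cells → ℝ)
    (Λ : Submodule ℤ (EuclideanSpace ℝ (Fin d))) (t : ℝ) : Set (EuclideanSpace ℝ (Fin d) ⧸ Λ) :=
  Λ.mkQ '' K.sublevel f t

/-! ### Merge trees -/

section MergeTree

variable {X : Type} [TopologicalSpace X]

/-- The sublevel space of a family of sublevel sets `S t`, with the topology of `X × ℝ`. -/
def SublevelSpace (S : ℝ → Set X) : Type := {q : X × ℝ // q.1 ∈ S q.2}

instance (S : ℝ → Set X) : TopologicalSpace (SublevelSpace S) :=
  inferInstanceAs (TopologicalSpace {q : X × ℝ // q.1 ∈ S q.2})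

/-- The connected component of `S s` containing `x`, for a point `(x, s)` of the sublevel space. -/
def SublevelSpace.component {S : ℝ → Set X} (q : SublevelSpace S) : Set X :=
  connectedComponentIn (S q.1.2) q.1.1

/-- `(x, s) ∼ (y, t)` if `s = t` and `x`, `y` lie in the same connected component of `S s`. -/
def mergeSetoid (S : ℝ → Set X) : Setoid (SublevelSpace S) where
  r q r := q.1.2 = r.1.2 ∧ q.component = r.component
  iseqv := ⟨fun _ => ⟨rfl, rfl⟩, fun h => ⟨h.1.symm, h.2.symm⟩,
    fun h h' => ⟨h.1.trans h'.1, h.2.trans h'.2⟩⟩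

/-- The merge tree, with the quotient topology. -/
def MergeTree (S : ℝ → Set X) : Type := Quotient (mergeSetoid S)

instance (S : ℝ → Set X) : TopologicalSpace (MergeTree S) :=
  inferInstanceAs (TopologicalSpace (Quotient (mergeSetoid S)))

/-- The height function. -/
def MergeTree.height {S : ℝ → Set X} : MergeTree S → ℝ :=
  Quotient.lift (fun q : SublevelSpace S => q.1.2) fun _ _ h => h.1

/-- The connected component that a point of the merge tree represents. -/
def MergeTree.component {S : ℝ → Set X} : MergeTree S → Set X :=
  Quotient.lift (fun q : SublevelSpace S => q.component) fun _ _ h => h.2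

/-- `b` covers `a`. -/
def MergeTree.Covers {S : ℝ → Set X} (b a : MergeTree S) : Prop :=
  a.height ≤ b.height ∧ a.component ⊆ b.component

end MergeTree

/-! ### Shadow monomials -/

/-- A monomial `coeff * R ^ exp`. -/
@[ext] structure Monomial where
  coeff : ℝ
  exp : ℕ

/-- Monomials are compared by exponent first, and then by coefficient. -/
instance : LE Monomial := ⟨fun m n => m.exp < n.exp ∨ (m.exp = n.exp ∧ m.coeff ≤ n.coeff)⟩

/-- Division of a monomial by a natural number. -/
def Monomial.divNat (m : Monomial) (n : ℕ) : Monomial := ⟨m.coeff / n, m.exp⟩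

/-- The `p`-dimensional volume of a unit cell of a `p`-dimensional lattice `L` in `ℝ^d`: the covolume
of `L` in its real span, with respect to the Lebesgue measure of that Euclidean space. -/
def latticeVolume (L : Submodule ℤ (EuclideanSpace ℝ (Fin d))) : ℝ :=
  ZLattice.covolume
    (L.comap ((Submodule.span ℝ (L : Set (EuclideanSpace ℝ (Fin d)))).subtype.restrictScalars ℤ))
    (stdOrthonormalBasis ℝ (Submodule.span ℝ (L : Set (EuclideanSpace ℝ (Fin d))))).toBasis.addHaar

/-- The volume `ν_q` of the unit ball of `ℝ^q`. -/
def unitBallVolume (q : ℕ) : ℝ :=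
  (MeasureTheory.volume (Metric.ball (0 : EuclideanSpace ℝ (Fin q)) 1)).toReal

/-- `c` is a shadow of `C ⊆ ℝ^d/Λ`: a connected component of the preimage of `C` in `ℝ^d`. -/
def IsShadow (Λ : Submodule ℤ (EuclideanSpace ℝ (Fin d)))
    (C : Set (EuclideanSpace ℝ (Fin d) ⧸ Λ)) (c : Set (EuclideanSpace ℝ (Fin d))) : Prop :=
  ∃ x ∈ Λ.mkQ ⁻¹' C, c = connectedComponentIn (Λ.mkQ ⁻¹' C) x

/-- The periodicity lattice `Λ_C`: the vectors of `Λ` that keep the shadows of `C` invariant. -/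
def periodicityLattice (Λ : Submodule ℤ (EuclideanSpace ℝ (Fin d)))
    (C : Set (EuclideanSpace ℝ (Fin d) ⧸ Λ)) : Submodule ℤ (EuclideanSpace ℝ (Fin d)) :=
  AddSubgroup.toIntSubmodule
    { carrier := {u | u ∈ Λ ∧ ∀ c, IsShadow Λ C c → u +ᵥ c = c}
      zero_mem' := ⟨Λ.zero_mem, fun c _ => zero_vadd _ c⟩
      add_mem' := fun {u v} hu hv =>
        ⟨Λ.add_mem hu.1 hv.1, fun c hc => by rw [add_vadd, hv.2 c hc, hu.2 c hc]⟩
      neg_mem' := fun {u} hu =>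
        ⟨Λ.neg_mem hu.1, fun c hc => by rw [neg_vadd_eq_iff, hu.2 c hc]⟩ }

/-- The shadow monomial `vol_p(Λ_C) / vol_d(Λ) * ν_{d-p} * R^{d-p}`, with `p = dim Λ_C`. -/
def shadowMonomial (Λ : Submodule ℤ (EuclideanSpace ℝ (Fin d)))
    (C : Set (EuclideanSpace ℝ (Fin d) ⧸ Λ)) : Monomial where
  coeff := latticeVolume (periodicityLattice Λ C) / latticeVolume Λ *
    unitBallVolume (d - Module.finrank ℤ (periodicityLattice Λ C))
  exp := d - Module.finrank ℤ (periodicityLattice Λ C)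

/-! ### Periodic merge trees -/

/-- A topological space with a height function, a covering relation and a frequency function. This
is only the common format of periodic merge trees and of their subtrees. -/
structure DecoratedTree where
  Pt : Type
  [top : TopologicalSpace Pt]
  height : Pt → ℝ
  Covers : Pt → Pt → Prop
  freq : Pt → Monomial

attribute [instance] DecoratedTree.top

/-- The merge tree of the quotient filter `f/Λ`, with its height and frequency functions. -/
def decoratedMergeTree (K : CellComplex d) (f : K.cells → ℝ)
    (Λ : Submodule ℤ (EuclideanSpace ℝ (Fin d))) : DecoratedTree where
  Pt := MergeTree (K.quotientSublevel f Λ)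
  height := MergeTree.height
  Covers := MergeTree.Covers
  freq C := shadowMonomial Λ C.component

/-- A periodic merge tree (in dimension `d`) is the decorated merge tree of a `Λ`-periodic filter
on a locally finite `Λ`-periodic complex in `ℝ^d`, for some full-dimensional lattice `Λ`. -/
def PeriodicMergeTree (d : ℕ) : Type 1 :=
  {T : DecoratedTree // ∃ (K : CellComplex d) (f : K.cells → ℝ)
    (Λ : Submodule ℤ (EuclideanSpace ℝ (Fin d))) (_ : DiscreteTopology Λ),
    IsZLattice ℝ Λ ∧ K.IsPeriodicFilter f Λ ∧ T = decoratedMergeTree K f Λ}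

/-- The periodic merge tree of the `Λ`-periodic filter `f` with respect to `Λ`. -/
def perMTree (K : CellComplex d) (f : K.cells → ℝ)
    (Λ : Submodule ℤ (EuclideanSpace ℝ (Fin d))) [hd : DiscreteTopology Λ] [hz : IsZLattice ℝ Λ]
    (hf : K.IsPeriodicFilter f Λ) : PeriodicMergeTree d :=
  ⟨decoratedMergeTree K f Λ, K, f, Λ, hd, hz, hf, rfl⟩

/-! ### Interleaving distance, splintering, interleaving pseudo-distance -/

/-- The subtree with topmost point `C`: the points covered by `C`. -/
def DecoratedTree.subtree (T : DecoratedTree) (C : T.Pt) : DecoratedTree where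
  Pt := {A : T.Pt // T.Covers C A}
  height A := T.height A
  Covers B A := T.Covers B.1 A.1
  freq A := T.freq A

/-- The maps `φ`, `ψ` are `ε`-compatible. -/
structure IsCompatible (T T' : DecoratedTree) (ε : ℝ≥0) (φ : T.Pt → T'.Pt) (ψ : T'.Pt → T.Pt) :
    Prop where
  continuous_left : Continuous φ
  continuous_right : Continuous ψ
  height_left : ∀ C, T'.height (φ C) = T.height C + ε
  height_right : ∀ C', T.height (ψ C') = T'.height C' + ε
  covers_left : ∀ C, T.Covers (ψ (φ C)) C
  covers_right : ∀ C', T'.Covers (φ (ψ C')) C'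
  freq_left : ∀ C, T'.freq (φ C) ≤ T.freq C
  freq_right : ∀ C', T.freq (ψ C') ≤ T'.freq C'

/-- The interleaving distance: the infimum of the `ε ≥ 0` for which there are `ε`-compatible maps
(`∞` if there is no such `ε`). -/
def interleavingDist (T T' : DecoratedTree) : ℝ≥0∞ :=
  ⨅ ε ∈ {ε : ℝ≥0 | ∃ φ ψ, IsCompatible T T' ε φ ψ}, (ε : ℝ≥0∞)

/-- `T'` splinters `T`. -/
def Splinters (T' T : DecoratedTree) : Prop :=
  ∃ ω : T'.Pt → T.Pt, Continuous ω ∧ Function.Surjective ω ∧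
    (∀ A, T.height (ω A) = T'.height A) ∧
    ∀ C : T.Pt, (ω ⁻¹' {C}).Finite ∧ ∀ A ∈ ω ⁻¹' {C}, ∀ B ∈ ω ⁻¹' {C},
      interleavingDist (T'.subtree A) (T'.subtree B) = 0 ∧
      ω '' {X | T'.Covers A X} = {Y | T.Covers C Y} ∧
      ω '' {X | T'.Covers B X} = {Y | T.Covers C Y} ∧
      T'.freq A = T'.freq B ∧
      T'.freq B = (T.freq C).divNat (ω ⁻¹' {C}).ncard

/-- Two periodic merge trees are equivalent if some periodic merge tree splinters both. -/
def Equivalent (M N : PeriodicMergeTree d) : Prop :=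
  ∃ T : PeriodicMergeTree d, Splinters T.1 M.1 ∧ Splinters T.1 N.1

/-- The class `[M]` of the periodic merge trees equivalent to `M`. -/
def equivClass (M : PeriodicMergeTree d) : Set (PeriodicMergeTree d) :=
  {N | Equivalent N M}

/-- The interleaving pseudo-distance: the infimum of `∑ i, D(M i, M' i)` over all finite sequences
with `M 0` in the first class, the last `M' i` in the second class, and `M' i` equivalent to
`M (i+1)`. -/
def interleavingPseudoDist (𝒜 ℬ : Set (PeriodicMergeTree d)) : ℝ≥0∞ :=
  sInf {r | ∃ (k : ℕ) (M M' : Fin (k + 1) → PeriodicMergeTree d),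
    M 0 ∈ 𝒜 ∧ M' (Fin.last k) ∈ ℬ ∧
    (∀ i : Fin k, Equivalent (M' i.castSucc) (M i.succ)) ∧
    r = ∑ i, interleavingDist (M i).1 (M' i).1}

end PeriodicMerge

end

/-! Lattices of full dimension inside `Λ` have finite index, so `Λ' ⊓ Λ''` is again one, and the
tree of `f` over it serves as common splintering. It remains to show that for `Λ₀ ≤ Λ` the
projection ℝ^d/Λ₀ → ℝ^d/Λ induces a splintering (`splinters_of_le`).

Local finiteness makes every component of a quotient sublevel set the image of a component in ℝ^d
(`connectedComponentIn_quotientSublevel`). A point of the tree over `Λ` is thus a Λ-orbit of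
components of some K_t, and the fiber over Γ is the set of Λ₀-orbits into which this orbit falls.
The group Λ acts transitively on the fiber with stabilizer Λ₀ + Λ_Γ, so the fiber has N = [Λ : Λ₀ +
Λ_Γ] points (`finite_preimage_projTree`), and translations identify the subtrees below them, which
puts these at distance 0.

For the frequencies, the periodicity lattice over Λ₀ is Λ₀ ∩ Λ_Γ. With i = [Λ_Γ : Λ₀ ∩ Λ_Γ], its
volume is i · vol(Λ_Γ), while the second isomorphism theorem gives vol(Λ₀) = i · N · vol(Λ). The
rank is unchanged and i cancels, so the frequency is divided by exactly N
(`shadowMonomial_eq_divNat`). -/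

namespace PeriodicMerge

variable {d : ℕ}

/-! ### Lattices: finite index, real span and volume -/

section Lattice

theorem discreteTopology_of_le {E : Type*} [NormedAddCommGroup E]
    {L₁ L₂ : Submodule ℤ E} (h : L₁ ≤ L₂) [DiscreteTopology L₂] :
    DiscreteTopology L₁ :=
  DiscreteTopology.of_subset (s := (L₂ : Set E)) (t := (L₁ : Set E)) ‹_› h

variable {E : Type*} [NormedAddCommGroup E] [NormedSpace ℝ E]

/-- Finite index puts a positive multiple of each vector of `L₂` into `L₁`, and real scalars can
divide by it. -/
theorem span_real_eq_of_relIndex_ne_zero {L₁ L₂ : Submodule ℤ E} (h : L₁ ≤ L₂)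
    (hi : L₁.toAddSubgroup.relIndex L₂.toAddSubgroup ≠ 0) :
    Submodule.span ℝ (L₁ : Set E) = Submodule.span ℝ (L₂ : Set E) := by
  refine le_antisymm (Submodule.span_mono h) (Submodule.span_le.2 fun x hx => ?_)
  obtain ⟨n, hn, -, hnx⟩ := AddSubgroup.exists_nsmul_mem_of_relIndex_ne_zero hi
    (show x ∈ L₂.toAddSubgroup from hx)
  have hnx' : n • x ∈ L₁ := hnx.1
  have hn' : (n : ℝ) ≠ 0 := by exact_mod_cast Nat.pos_iff_ne_zero.1 hn
  have hx' : x = (n : ℝ)⁻¹ • (n • x) := by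
    rw [← Nat.cast_smul_eq_nsmul ℝ, smul_smul, inv_mul_cancel₀ hn', one_smul]
  rw [hx']
  exact Submodule.smul_mem _ _ (Submodule.subset_span hnx')

theorem finrank_int_eq_finrank_span [FiniteDimensional ℝ E] (L : Submodule ℤ E)
    [DiscreteTopology L] :
    Module.finrank ℤ L = Module.finrank ℝ (Submodule.span ℝ (L : Set E)) := by
  have h := Real.finrank_eq_int_finrank_of_discrete (s := (L : Set E))
    (by rw [Submodule.span_eq]; infer_instance)
  rw [Set.finrank, Set.finrank, Submodule.span_eq] at h
  exact h.symm

end Lattice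

theorem relIndex_ne_zero_of_isZLattice {L₁ L₂ : Submodule ℤ (EuclideanSpace ℝ (Fin d))}
    [DiscreteTopology L₁] [IsZLattice ℝ L₁] [DiscreteTopology L₂] [IsZLattice ℝ L₂] (h : L₁ ≤ L₂) :
    L₁.toAddSubgroup.relIndex L₂.toAddSubgroup ≠ 0 := by
  rw [← Nat.cast_ne_zero (R := ℝ), ← ZLattice.covolume_div_covolume_eq_relIndex' _ _ h]
  exact div_ne_zero (ZLattice.covolume_ne_zero _ _) (ZLattice.covolume_ne_zero _ _)

/-- The subspace `S` is kept apart from the span of `L` so that two lattices with equal spans can be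
compared inside one and the same space. -/
theorem isZLattice_restrict {L : Submodule ℤ (EuclideanSpace ℝ (Fin d))} [DiscreteTopology L]
    {S : Submodule ℝ (EuclideanSpace ℝ (Fin d))}
    (hS : Submodule.span ℝ (L : Set (EuclideanSpace ℝ (Fin d))) = S) :
    ∃ _ : DiscreteTopology (L.comap (S.subtype.restrictScalars ℤ)),
      IsZLattice ℝ (L.comap (S.subtype.restrictScalars ℤ)) := by
  have hdisc : DiscreteTopology (L.comap (S.subtype.restrictScalars ℤ)) :=
    DiscreteTopology.preimage_of_continuous_injective (L : Set (EuclideanSpace ℝ (Fin d)))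
      (f := S.subtype) continuous_subtype_val Subtype.val_injective
  refine ⟨hdisc, ⟨?_⟩⟩
  subst hS
  rw [eq_top_iff, ← Submodule.span_span_coe_preimage]
  exact Submodule.span_mono fun x hx => hx

theorem latticeVolume_eq {L : Submodule ℤ (EuclideanSpace ℝ (Fin d))}
    {S : Submodule ℝ (EuclideanSpace ℝ (Fin d))}
    (hS : Submodule.span ℝ (L : Set (EuclideanSpace ℝ (Fin d))) = S) :
    latticeVolume L = ZLattice.covolume (L.comap (S.subtype.restrictScalars ℤ)) := by
  subst hS
  rw [latticeVolume, OrthonormalBasis.addHaar_eq_volume]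

/-- Both lattices have full rank in their common real span, where the ratio of covolumes is the
index. -/
theorem latticeVolume_of_relIndex_ne_zero {L₁ L₂ : Submodule ℤ (EuclideanSpace ℝ (Fin d))}
    [DiscreteTopology L₂] (h : L₁ ≤ L₂)
    (hi : L₁.toAddSubgroup.relIndex L₂.toAddSubgroup ≠ 0) :
    latticeVolume L₁ = L₁.toAddSubgroup.relIndex L₂.toAddSubgroup * latticeVolume L₂ := by
  have := discreteTopology_of_le h
  have hS := span_real_eq_of_relIndex_ne_zero h hi
  obtain ⟨_, _⟩ := isZLattice_restrict hS
  obtain ⟨_, _⟩ := isZLattice_restrict (L := L₂) rfl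
  rw [latticeVolume_eq hS, latticeVolume_eq (L := L₂) rfl]
  rw [← div_eq_iff (ZLattice.covolume_ne_zero _ _),
    ZLattice.covolume_div_covolume_eq_relIndex' _ _ (Submodule.comap_mono h), Nat.cast_inj]
  -- Each lattice is the image of its restriction to the span under the injective inclusion, so the
  -- index is the same in the span and in ℝ^d.
  have key (T : Submodule ℤ (EuclideanSpace ℝ (Fin d))) (S : Submodule ℝ (EuclideanSpace ℝ (Fin d)))
      (hTS : T ≤ S.restrictScalars ℤ) :
      T.toAddSubgroup = (T.comap (S.subtype.restrictScalars ℤ)).toAddSubgroup.map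
        S.subtype.toAddMonoidHom := by
    ext x
    constructor
    · exact fun hx => ⟨⟨x, hTS hx⟩, hx, rfl⟩
    · rintro ⟨y, hy, rfl⟩
      exact hy
  have h₂ : L₂ ≤ (Submodule.span ℝ (L₂ : Set (EuclideanSpace ℝ (Fin d)))).restrictScalars ℤ :=
    fun _ hx => Submodule.subset_span hx
  rw [key L₁ _ (h.trans h₂), key L₂ _ h₂,
    AddSubgroup.relIndex_map_map_of_injective _ _ Subtype.val_injective]

theorem finrank_eq_of_relIndex_ne_zero {L₁ L₂ : Submodule ℤ (EuclideanSpace ℝ (Fin d))}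
    [DiscreteTopology L₂] (h : L₁ ≤ L₂)
    (hi : L₁.toAddSubgroup.relIndex L₂.toAddSubgroup ≠ 0) :
    Module.finrank ℤ L₁ = Module.finrank ℤ L₂ := by
  have := discreteTopology_of_le h
  rw [finrank_int_eq_finrank_span, finrank_int_eq_finrank_span,
    span_real_eq_of_relIndex_ne_zero h hi]

theorem isZLattice_inf {L L₁ L₂ : Submodule ℤ (EuclideanSpace ℝ (Fin d))}
    [DiscreteTopology L] [IsZLattice ℝ L] [DiscreteTopology L₁] [IsZLattice ℝ L₁]
    [DiscreteTopology L₂] [IsZLattice ℝ L₂] (h₁ : L₁ ≤ L) (h₂ : L₂ ≤ L) :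
    ∃ _ : DiscreteTopology (L₁ ⊓ L₂ : Submodule ℤ (EuclideanSpace ℝ (Fin d))),
      IsZLattice ℝ (L₁ ⊓ L₂ : Submodule ℤ (EuclideanSpace ℝ (Fin d))) := by
  have hdisc : DiscreteTopology (L₁ ⊓ L₂ : Submodule ℤ (EuclideanSpace ℝ (Fin d))) :=
    discreteTopology_of_le inf_le_left
  refine ⟨hdisc, ⟨?_⟩⟩
  have hi : (L₁ ⊓ L₂).toAddSubgroup.relIndex L.toAddSubgroup ≠ 0 := by
    have hA : (L₁ ⊓ L₂).toAddSubgroup = L₁.toAddSubgroup ⊓ L₂.toAddSubgroup := rfl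
    rw [hA]
    exact AddSubgroup.relIndex_inf_ne_zero (relIndex_ne_zero_of_isZLattice h₁)
      (relIndex_ne_zero_of_isZLattice h₂)
  rw [span_real_eq_of_relIndex_ne_zero (inf_le_left.trans h₁) hi, IsZLattice.span_top]

/-! ### Components of sublevel sets in ℝ^d -/

namespace CellComplex

variable (K : CellComplex d) (f : K.cells → ℝ)

theorem isClosed_cell (σ : K.cells) : IsClosed σ.1 := by
  obtain ⟨h, -⟩ := K.exists_homeomorph σ
  have : CompactSpace σ.1 := h.compactSpace
  exact (isCompact_iff_compactSpace.2 this).isClosed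

theorem isPreconnected_cell (σ : K.cells) : IsPreconnected σ.1 := by
  obtain ⟨h, -⟩ := K.exists_homeomorph σ
  have : PreconnectedSpace
      (Metric.closedBall (0 : EuclideanSpace ℝ (Fin (K.dim σ))) 1) :=
    isPreconnected_iff_preconnectedSpace.1 (convex_closedBall _ _).isPreconnected
  have hr := isPreconnected_range (continuous_subtype_val.comp h.continuous)
  rwa [h.surjective.range_comp, Subtype.range_coe] at hr

variable {K f}

theorem mem_sublevel {t : ℝ} {x : EuclideanSpace ℝ (Fin d)} :
    x ∈ K.sublevel f t ↔ ∃ σ : K.cells, f σ ≤ t ∧ x ∈ σ.1 := by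
  simp [sublevel]

theorem sublevel_mono {s t : ℝ} (h : s ≤ t) : K.sublevel f s ⊆ K.sublevel f t := fun x hx => by
  obtain ⟨σ, hσ, hx⟩ := mem_sublevel.1 hx
  exact mem_sublevel.2 ⟨σ, hσ.trans h, hx⟩

/-- Such a set is the union of the cells it contains, a locally finite union of compact sets. -/
theorem isClosed_of_saturated {t : ℝ} {U : Set (EuclideanSpace ℝ (Fin d))}
    (hU : U ⊆ K.sublevel f t)
    (hsat : ∀ σ : K.cells, f σ ≤ t → (σ.1 ∩ U).Nonempty → σ.1 ⊆ U) : IsClosed U := by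
  have hU' : U = ⋃ σ : {σ : K.cells // f σ ≤ t ∧ σ.1 ⊆ U}, σ.1.1 := by
    refine Set.Subset.antisymm (fun x hx => ?_) (Set.iUnion_subset fun σ => σ.2.2)
    obtain ⟨σ, hσ, hxσ⟩ := mem_sublevel.1 (hU hx)
    exact Set.mem_iUnion.2 ⟨⟨σ, hσ, hsat σ hσ ⟨x, hxσ, hx⟩⟩, hxσ⟩
  rw [hU']
  exact (K.locallyFinite.comp_injective Subtype.val_injective).isClosed_iUnion
    fun σ => K.isClosed_cell σ.1

variable (K f) in
/-- The connected component of `x` in the sublevel set `K_t`. -/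
def comp (t : ℝ) (x : EuclideanSpace ℝ (Fin d)) : Set (EuclideanSpace ℝ (Fin d)) :=
  connectedComponentIn (K.sublevel f t) x

theorem comp_subset (t : ℝ) (x : EuclideanSpace ℝ (Fin d)) : K.comp f t x ⊆ K.sublevel f t :=
  connectedComponentIn_subset _ _

theorem mem_comp {t : ℝ} {x : EuclideanSpace ℝ (Fin d)} (hx : x ∈ K.sublevel f t) :
    x ∈ K.comp f t x :=
  mem_connectedComponentIn hx

theorem comp_eq {t : ℝ} {x y : EuclideanSpace ℝ (Fin d)} (hy : y ∈ K.comp f t x) :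
    K.comp f t x = K.comp f t y :=
  connectedComponentIn_eq hy

theorem cell_subset_comp {t : ℝ} {x y : EuclideanSpace ℝ (Fin d)} {σ : K.cells} (hσ : f σ ≤ t)
    (hyσ : y ∈ σ.1) (hy : y ∈ K.comp f t x) : σ.1 ⊆ K.comp f t x := by
  rw [comp_eq hy]
  exact (K.isPreconnected_cell σ).subset_connectedComponentIn hyσ
    fun z hz => mem_sublevel.2 ⟨σ, hσ, hz⟩

theorem comp_subset_comp {s t : ℝ} (h : s ≤ t) {x y : EuclideanSpace ℝ (Fin d)}
    (hy : y ∈ K.comp f t x) : K.comp f s y ⊆ K.comp f t x := by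
  rw [comp_eq hy]
  exact connectedComponentIn_mono _ (sublevel_mono h)

/-! ### Components on the torus, shadows and periodicity lattices -/

namespace IsPeriodicFilter

variable {Λ : Submodule ℤ (EuclideanSpace ℝ (Fin d))} (hf : K.IsPeriodicFilter f Λ)
include hf

theorem vadd_mem_sublevel {t : ℝ} {u x : EuclideanSpace ℝ (Fin d)} (hu : u ∈ Λ)
    (hx : x ∈ K.sublevel f t) : u + x ∈ K.sublevel f t := by
  obtain ⟨σ, hσ, hxσ⟩ := mem_sublevel.1 hx
  refine mem_sublevel.2 ⟨⟨u +ᵥ σ.1, hf.isPeriodic _ σ.2 u hu⟩, ?_, Set.vadd_mem_vadd_set hxσ⟩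
  rwa [hf.isPeriodicFun σ _ u hu rfl]

theorem vadd_sublevel (t : ℝ) {u : EuclideanSpace ℝ (Fin d)} (hu : u ∈ Λ) :
    u +ᵥ K.sublevel f t = K.sublevel f t := by
  ext x
  rw [Set.mem_vadd_set_iff_neg_vadd_mem]
  refine ⟨fun h => ?_, fun h => hf.vadd_mem_sublevel (Λ.neg_mem hu) h⟩
  simpa using hf.vadd_mem_sublevel hu h

theorem vadd_comp {t : ℝ} {u x : EuclideanSpace ℝ (Fin d)} (hu : u ∈ Λ)
    (hx : x ∈ K.sublevel f t) : u +ᵥ K.comp f t x = K.comp f t (u + x) := by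
  have h := (Homeomorph.addLeft u).image_connectedComponentIn hx
  have h' : Homeomorph.addLeft u '' K.sublevel f t = K.sublevel f t := hf.vadd_sublevel t hu
  rw [h'] at h
  exact h

theorem mkQ_mem_quotientSublevel {t : ℝ} {x : EuclideanSpace ℝ (Fin d)} :
    Λ.mkQ x ∈ K.quotientSublevel f Λ t ↔ x ∈ K.sublevel f t := by
  refine ⟨?_, fun h => ⟨x, h, rfl⟩⟩
  rintro ⟨y, hy, hxy⟩
  have h : x - y ∈ Λ := (Submodule.Quotient.eq Λ).1 hxy.symm
  simpa using hf.vadd_mem_sublevel h hy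

theorem preimage_quotientSublevel (t : ℝ) :
    Λ.mkQ ⁻¹' K.quotientSublevel f Λ t = K.sublevel f t :=
  Set.ext fun _ => hf.mkQ_mem_quotientSublevel

theorem mkQ_mem_image_comp {t : ℝ} {x y : EuclideanSpace ℝ (Fin d)} (hx : x ∈ K.sublevel f t) :
    Λ.mkQ y ∈ Λ.mkQ '' K.comp f t x ↔ ∃ u ∈ Λ, y ∈ K.comp f t (u + x) := by
  constructor
  · rintro ⟨z, hz, hzy⟩
    have h : y - z ∈ Λ := (Submodule.Quotient.eq Λ).1 hzy.symm
    refine ⟨y - z, h, ?_⟩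
    rw [← hf.vadd_comp h hx]
    exact ⟨z, hz, sub_add_cancel y z⟩
  · rintro ⟨u, hu, hy⟩
    rw [← hf.vadd_comp hu hx] at hy
    obtain ⟨z, hz, rfl⟩ := hy
    exact ⟨z, hz, (Submodule.Quotient.eq Λ).2 (by simpa using Λ.neg_mem hu)⟩

/-- The components of the quotient sublevel sets are the images of the components upstairs. -/
theorem connectedComponentIn_quotientSublevel {t : ℝ} {x : EuclideanSpace ℝ (Fin d)}
    (hx : x ∈ K.sublevel f t) :
    connectedComponentIn (K.quotientSublevel f Λ t) (Λ.mkQ x) = Λ.mkQ '' K.comp f t x := by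
  refine Set.Subset.antisymm ?_
    (Λ.continuous_mkQ.continuousOn.image_connectedComponentIn_subset hx)
  set C := Λ.mkQ '' K.comp f t x
  have hCS : C ⊆ K.quotientSublevel f Λ t := Set.image_mono (comp_subset t x)
  have hsat : ∀ σ : K.cells, f σ ≤ t → (σ.1 ∩ Λ.mkQ ⁻¹' C).Nonempty → σ.1 ⊆ Λ.mkQ ⁻¹' C := by
    rintro σ hσ ⟨y, hyσ, hy⟩ z hz
    obtain ⟨u, hu, hy⟩ := (hf.mkQ_mem_image_comp hx).1 hy
    exact (hf.mkQ_mem_image_comp hx).2 ⟨u, hu, cell_subset_comp hσ hyσ hy hz⟩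
  have hC : IsClosed C := by
    rw [← Λ.isQuotientMap_mkQ.isClosed_preimage]
    refine isClosed_of_saturated (t := t) (f := f) ?_ hsat
    rw [← hf.preimage_quotientSublevel]
    exact Set.preimage_mono hCS
  -- The rest of the sublevel set is also a union of cells upstairs. Hence `C` is clopen in the
  -- sublevel set, and a connected set that meets `C` cannot leave it.
  have hC' : IsClosed (K.quotientSublevel f Λ t \ C) := by
    rw [← Λ.isQuotientMap_mkQ.isClosed_preimage, Set.preimage_sdiff, hf.preimage_quotientSublevel]
    refine isClosed_of_saturated Set.sdiff_subset ?_
    rintro σ hσ ⟨y, hyσ, -, hy⟩ z hz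
    exact ⟨mem_sublevel.2 ⟨σ, hσ, hz⟩, fun hz' => hy (hsat σ hσ ⟨z, hz, hz'⟩ hyσ)⟩
  have hxC : Λ.mkQ x ∈ C := Set.mem_image_of_mem _ (mem_comp hx)
  intro y hy
  by_contra hyC
  have hpre := isPreconnected_closed_iff.1
    (isPreconnected_connectedComponentIn (F := K.quotientSublevel f Λ t) (x := Λ.mkQ x)) _ _ hC hC'
    (by rw [Set.union_sdiff_self]
        exact (connectedComponentIn_subset _ _).trans Set.subset_union_right)
    ⟨_, mem_connectedComponentIn (hCS hxC), hxC⟩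
    ⟨y, hy, connectedComponentIn_subset _ _ hy, hyC⟩
  obtain ⟨z, -, hz, -, hz'⟩ := hpre
  exact hz' hz

/-- The preimage of the image is the union of the Λ-translates of the component. It lies in the
sublevel set, of which each translate is already a full component. -/
theorem isShadow_image_comp {t : ℝ} {x : EuclideanSpace ℝ (Fin d)} (hx : x ∈ K.sublevel f t)
    {c : Set (EuclideanSpace ℝ (Fin d))} :
    IsShadow Λ (Λ.mkQ '' K.comp f t x) c ↔ ∃ u ∈ Λ, c = u +ᵥ K.comp f t x := by
  have hsub : Λ.mkQ ⁻¹' (Λ.mkQ '' K.comp f t x) ⊆ K.sublevel f t := by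
    rw [← hf.preimage_quotientSublevel]
    exact Set.preimage_mono (Set.image_mono (comp_subset t x))
  have key : ∀ y u, u ∈ Λ → y ∈ K.comp f t (u + x) →
      connectedComponentIn (Λ.mkQ ⁻¹' (Λ.mkQ '' K.comp f t x)) y = u +ᵥ K.comp f t x := by
    intro y u hu hy
    rw [hf.vadd_comp hu hx]
    refine Set.Subset.antisymm ?_ ?_
    · rw [comp_eq hy]
      exact connectedComponentIn_mono _ hsub
    · exact isPreconnected_connectedComponentIn.subset_connectedComponentIn hy
        fun z hz => (hf.mkQ_mem_image_comp hx).2 ⟨u, hu, hz⟩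
  constructor
  · rintro ⟨y, hy, rfl⟩
    obtain ⟨u, hu, hy⟩ := (hf.mkQ_mem_image_comp hx).1 hy
    exact ⟨u, hu, key y u hu hy⟩
  · rintro ⟨u, hu, rfl⟩
    have hux := mem_comp (hf.vadd_mem_sublevel hu hx)
    exact ⟨u + x, (hf.mkQ_mem_image_comp hx).2 ⟨u, hu, hux⟩, (key _ u hu hux).symm⟩

/-- All shadows are translates of one another and translations commute, so fixing one shadow fixes
all. -/
theorem mem_periodicityLattice {t : ℝ} {x : EuclideanSpace ℝ (Fin d)} (hx : x ∈ K.sublevel f t)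
    {u : EuclideanSpace ℝ (Fin d)} :
    u ∈ periodicityLattice Λ (Λ.mkQ '' K.comp f t x) ↔
      u ∈ Λ ∧ u +ᵥ K.comp f t x = K.comp f t x := by
  change (u ∈ Λ ∧ ∀ c, IsShadow Λ (Λ.mkQ '' K.comp f t x) c → u +ᵥ c = c) ↔ _
  refine and_congr_right fun _ => ⟨fun h => ?_, fun h c hc => ?_⟩
  · exact h _ ((hf.isShadow_image_comp hx).2 ⟨0, Λ.zero_mem, (zero_vadd _ _).symm⟩)
  · obtain ⟨v, -, rfl⟩ := (hf.isShadow_image_comp hx).1 hc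
    rw [vadd_comm, h]

theorem periodicityLattice_eq_inf {Λ₀ : Submodule ℤ (EuclideanSpace ℝ (Fin d))} (hle : Λ₀ ≤ Λ)
    {t : ℝ} {x : EuclideanSpace ℝ (Fin d)} (hx : x ∈ K.sublevel f t) :
    periodicityLattice Λ₀ (Λ₀.mkQ '' K.comp f t x) =
      Λ₀ ⊓ periodicityLattice Λ (Λ.mkQ '' K.comp f t x) := by
  ext u
  rw [(hf.mono hle).mem_periodicityLattice hx, Submodule.mem_inf, hf.mem_periodicityLattice hx]
  exact ⟨fun h => ⟨h.1, hle h.1, h.2⟩, fun h => ⟨h.1, h.2.2⟩⟩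

end IsPeriodicFilter

end CellComplex

/-! ### Index computation for the frequency -/

theorem periodicityLattice_le (Λ : Submodule ℤ (EuclideanSpace ℝ (Fin d)))
    (C : Set (EuclideanSpace ℝ (Fin d) ⧸ Λ)) : periodicityLattice Λ C ≤ Λ :=
  fun _ h => h.1

theorem inf_relIndex_right_toAddSubgroup {E : Type*} [AddCommGroup E] (L P : Submodule ℤ E) :
    (L ⊓ P).toAddSubgroup.relIndex P.toAddSubgroup = L.toAddSubgroup.relIndex P.toAddSubgroup := by
  have h : (L ⊓ P).toAddSubgroup = L.toAddSubgroup ⊓ P.toAddSubgroup := rfl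
  rw [h, AddSubgroup.inf_relIndex_right]

/-- Second isomorphism theorem: the index of `L ⊓ P` in `P` is that of `L` in `L ⊔ P`. The rest is
the tower `L ≤ L ⊔ P ≤ M`. -/
theorem relIndex_mul_relIndex_sup {E : Type*} [AddCommGroup E] {L P M : Submodule ℤ E}
    (hL : L ≤ M) (hP : P ≤ M) :
    L.toAddSubgroup.relIndex P.toAddSubgroup * (L ⊔ P).toAddSubgroup.relIndex M.toAddSubgroup =
      L.toAddSubgroup.relIndex M.toAddSubgroup := by
  have h₁ : L.toAddSubgroup ≤ L.toAddSubgroup ⊔ P.toAddSubgroup := le_sup_left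
  have h₂ : L.toAddSubgroup ⊔ P.toAddSubgroup ≤ M.toAddSubgroup :=
    sup_le ((Submodule.toAddSubgroup_le _ _).2 hL) ((Submodule.toAddSubgroup_le _ _).2 hP)
  rw [Submodule.sup_toAddSubgroup, ← AddSubgroup.relIndex_mul_relIndex _ _ _ h₁ h₂,
    AddSubgroup.relIndex_sup_left]

/-- The frequency is divided by the number of orbits of shadows. -/
theorem shadowMonomial_eq_divNat {K : CellComplex d} {f : K.cells → ℝ}
    {Λ₀ Λ : Submodule ℤ (EuclideanSpace ℝ (Fin d))}
    [DiscreteTopology Λ₀] [IsZLattice ℝ Λ₀] [DiscreteTopology Λ] [IsZLattice ℝ Λ]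
    (hf : K.IsPeriodicFilter f Λ) (hle : Λ₀ ≤ Λ) {t : ℝ} {x : EuclideanSpace ℝ (Fin d)}
    (hx : x ∈ K.sublevel f t) :
    shadowMonomial Λ₀ (Λ₀.mkQ '' K.comp f t x) =
      (shadowMonomial Λ (Λ.mkQ '' K.comp f t x)).divNat
        ((Λ₀ ⊔ periodicityLattice Λ (Λ.mkQ '' K.comp f t x)).toAddSubgroup.relIndex
          Λ.toAddSubgroup) := by
  have hinf := hf.periodicityLattice_eq_inf hle hx
  have hPle := periodicityLattice_le Λ (Λ.mkQ '' K.comp f t x)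
  unfold shadowMonomial Monomial.divNat
  rw [hinf]
  generalize periodicityLattice Λ (Λ.mkQ '' K.comp f t x) = P at hPle
  have hPd : DiscreteTopology P := discreteTopology_of_le hPle
  have hI := relIndex_ne_zero_of_isZLattice hle
  have hmul := relIndex_mul_relIndex_sup hle hPle
  have hi := left_ne_zero_of_mul (hmul.trans_ne hI)
  have hi' := (inf_relIndex_right_toAddSubgroup Λ₀ P).trans_ne hi
  have hv := latticeVolume_of_relIndex_ne_zero inf_le_right hi'
  have hV := latticeVolume_of_relIndex_ne_zero hle hI
  rw [inf_relIndex_right_toAddSubgroup] at hv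
  rw [← hmul, Nat.cast_mul, mul_assoc] at hV
  -- The factor [P : Λ₀ ∩ P] occurs in both volumes and cancels; the factor [Λ : Λ₀ + P] stays in
  -- the denominator.
  rw [finrank_eq_of_relIndex_ne_zero inf_le_right hi', hv, hV,
    mul_div_mul_left _ _ (Nat.cast_ne_zero.2 hi), mul_comm (Nat.cast _), ← div_div,
    div_mul_eq_mul_div]

/-! ### Maps between merge trees -/

namespace MergeTree

variable {X Y : Type} [TopologicalSpace X] [TopologicalSpace Y] {S : ℝ → Set X} {S' : ℝ → Set Y}

theorem map_mem_connectedComponentIn {g : X → Y} (hg : Continuous g) {A : Set X} {B : Set Y}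
    (h : Set.MapsTo g A B) {x y : X} (hy : y ∈ connectedComponentIn A x) :
    g y ∈ connectedComponentIn B (g x) := by
  have hx : x ∈ A := connectedComponentIn_nonempty_iff.1 ⟨y, hy⟩
  exact connectedComponentIn_mono _ h.image_subset
    (hg.continuousOn.mapsTo_connectedComponentIn hx hy)

/-- The map of merge trees induced by a continuous map that respects the sublevel sets. -/
def map (g : X → Y) (hg : Continuous g) (h : ∀ t, Set.MapsTo g (S t) (S' t)) :
    MergeTree S → MergeTree S' :=
  Quotient.map (sa := mergeSetoid S) (sb := mergeSetoid S')
    (fun q => ⟨(g q.1.1, q.1.2), h _ q.2⟩) (by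
      rintro ⟨⟨x, s⟩, hx⟩ ⟨⟨y, t⟩, hy⟩ ⟨hst, hc⟩
      obtain rfl : s = t := hst
      refine ⟨rfl, (connectedComponentIn_eq (map_mem_connectedComponentIn hg (h s) ?_)).symm⟩
      change x ∈ connectedComponentIn (S s) y
      have hc' : connectedComponentIn (S s) x = connectedComponentIn (S s) y := hc
      exact hc' ▸ mem_connectedComponentIn hx)

theorem continuous_map (g : X → Y) (hg : Continuous g) (h : ∀ t, Set.MapsTo g (S t) (S' t)) :
    Continuous (map g hg h) := by
  refine Continuous.quotient_map' (Continuous.subtype_mk ?_ _) _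
  exact (hg.comp (continuous_fst.comp continuous_subtype_val)).prodMk
    (continuous_snd.comp continuous_subtype_val)

theorem height_map (g : X → Y) (hg : Continuous g) (h : ∀ t, Set.MapsTo g (S t) (S' t))
    (A : MergeTree S) : (map g hg h A).height = A.height := by
  induction A using Quotient.ind
  rfl

theorem Covers.map (hS' : Monotone S') {g : X → Y} (hg : Continuous g)
    (h : ∀ t, Set.MapsTo g (S t) (S' t)) {A B : MergeTree S} (hBA : B.Covers A) :
    (map g hg h B).Covers (map g hg h A) := by
  induction A using Quotient.ind with | _ a
  induction B using Quotient.ind with | _ b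
  obtain ⟨⟨x, s⟩, hx⟩ := a
  obtain ⟨⟨y, t⟩, hy⟩ := b
  obtain ⟨hst, hc⟩ := hBA
  replace hst : s ≤ t := hst
  refine ⟨hst, ?_⟩
  change connectedComponentIn (S' s) (g x) ⊆ connectedComponentIn (S' t) (g y)
  have hxy : x ∈ connectedComponentIn (S t) y := hc (mem_connectedComponentIn hx)
  rw [connectedComponentIn_eq (map_mem_connectedComponentIn hg (h t) hxy)]
  exact connectedComponentIn_mono _ (hS' hst)

end MergeTree

theorem interleavingDist_eq_zero {T T' : DecoratedTree} {φ : T.Pt → T'.Pt} {ψ : T'.Pt → T.Pt}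
    (h : IsCompatible T T' 0 φ ψ) : interleavingDist T T' = 0 :=
  le_antisymm (iInf₂_le_of_le 0 ⟨φ, ψ, h⟩ (by simp)) bot_le

theorem Monomial.le_refl (m : Monomial) : m ≤ m := Or.inr ⟨rfl, le_rfl⟩

theorem interleavingDist_self {T : DecoratedTree} (hT : ∀ A, T.Covers A A) :
    interleavingDist T T = 0 :=
  interleavingDist_eq_zero (φ := id) (ψ := id)
    { continuous_left := continuous_id
      continuous_right := continuous_id
      height_left := by simp
      height_right := by simp
      covers_left := hT
      covers_right := hT
      freq_left := fun _ => Monomial.le_refl _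
      freq_right := fun _ => Monomial.le_refl _ }

theorem MergeTree.covers_refl {X : Type} [TopologicalSpace X] {S : ℝ → Set X} (A : MergeTree S) :
    A.Covers A :=
  ⟨le_rfl, subset_rfl⟩

/-! ### Points of periodic merge trees -/

variable {K : CellComplex d} {f : K.cells → ℝ} {Λ Λ₀ : Submodule ℤ (EuclideanSpace ℝ (Fin d))}

theorem quotientSublevel_mono : Monotone (K.quotientSublevel f Λ) :=
  fun _ _ h => Set.image_mono (CellComplex.sublevel_mono h)

variable (Λ) in
/-- The point of the merge tree at height `t` given by a point `x` of the sublevel set `K_t`. -/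
def treePt {t : ℝ} {x : EuclideanSpace ℝ (Fin d)} (hx : x ∈ K.sublevel f t) :
    MergeTree (K.quotientSublevel f Λ) :=
  Quotient.mk (mergeSetoid _) ⟨(Λ.mkQ x, t), ⟨x, hx, rfl⟩⟩

theorem exists_treePt (A : MergeTree (K.quotientSublevel f Λ)) :
    ∃ (t : ℝ) (x : EuclideanSpace ℝ (Fin d)) (hx : x ∈ K.sublevel f t), A = treePt Λ hx := by
  induction A using Quotient.ind with | _ q
  obtain ⟨⟨y, t⟩, hy⟩ := q
  obtain ⟨x, hx, rfl⟩ : ∃ x ∈ K.sublevel f t, Λ.mkQ x = y := hy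
  exact ⟨t, x, hx, rfl⟩

theorem height_treePt {t : ℝ} {x : EuclideanSpace ℝ (Fin d)} (hx : x ∈ K.sublevel f t) :
    (treePt Λ hx).height = t :=
  rfl

theorem component_treePt (hf : K.IsPeriodicFilter f Λ) {t : ℝ} {x : EuclideanSpace ℝ (Fin d)}
    (hx : x ∈ K.sublevel f t) : (treePt Λ hx).component = Λ.mkQ '' K.comp f t x :=
  hf.connectedComponentIn_quotientSublevel hx

theorem image_comp_eq_iff (hf : K.IsPeriodicFilter f Λ) {t : ℝ} {x y : EuclideanSpace ℝ (Fin d)}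
    (hx : x ∈ K.sublevel f t) (hy : y ∈ K.sublevel f t) :
    Λ.mkQ '' K.comp f t x = Λ.mkQ '' K.comp f t y ↔
      ∃ u ∈ Λ, u +ᵥ K.comp f t x = K.comp f t y := by
  constructor
  · intro h
    have hyx : Λ.mkQ y ∈ Λ.mkQ '' K.comp f t x :=
      h ▸ Set.mem_image_of_mem _ (CellComplex.mem_comp hy)
    obtain ⟨u, hu, hyu⟩ := (hf.mkQ_mem_image_comp hx).1 hyx
    exact ⟨u, hu, by rw [hf.vadd_comp hu hx, CellComplex.comp_eq hyu]⟩
  · rintro ⟨u, hu, h⟩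
    rw [← h, ← Set.image_vadd, Set.image_image]
    refine Set.image_congr fun z _ => ((Submodule.Quotient.eq Λ).2 ?_).symm
    simpa using hu

/-- Dictionary between the tree and ℝ^d: points at height `t` are Λ-orbits of components of K_t. -/
theorem treePt_eq_iff (hf : K.IsPeriodicFilter f Λ) {t : ℝ} {x y : EuclideanSpace ℝ (Fin d)}
    (hx : x ∈ K.sublevel f t) (hy : y ∈ K.sublevel f t) :
    treePt Λ hx = treePt Λ hy ↔ ∃ u ∈ Λ, u +ᵥ K.comp f t x = K.comp f t y := by
  rw [← image_comp_eq_iff hf hx hy, ← component_treePt hf hx, ← component_treePt hf hy]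
  exact ⟨fun h => by rw [h], fun h => Quotient.sound (s := mergeSetoid _) ⟨rfl, h⟩⟩

/-- The map of merge trees induced by `ℝ^d/Λ₀ → ℝ^d/Λ` for a sublattice `Λ₀` of `Λ`. -/
def projTree (K : CellComplex d) (f : K.cells → ℝ) (hle : Λ₀ ≤ Λ) :
    MergeTree (K.quotientSublevel f Λ₀) → MergeTree (K.quotientSublevel f Λ) :=
  MergeTree.map (Λ₀.mapQ Λ LinearMap.id hle)
    (Λ₀.isQuotientMap_mkQ.continuous_iff.2 Λ.continuous_mkQ) (by
      rintro t _ ⟨x, hx, rfl⟩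
      exact ⟨x, hx, rfl⟩)

theorem projTree_treePt (hle : Λ₀ ≤ Λ) {t : ℝ} {x : EuclideanSpace ℝ (Fin d)}
    (hx : x ∈ K.sublevel f t) : projTree K f hle (treePt Λ₀ hx) = treePt Λ hx :=
  rfl

/-- Translation of the merge tree for `Λ₀` by a vector of a lattice with respect to which the filter
is periodic. -/
def translateTree (Λ₀ : Submodule ℤ (EuclideanSpace ℝ (Fin d))) (hf : K.IsPeriodicFilter f Λ)
    {u : EuclideanSpace ℝ (Fin d)} (hu : u ∈ Λ) :
    MergeTree (K.quotientSublevel f Λ₀) → MergeTree (K.quotientSublevel f Λ₀) :=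
  MergeTree.map (fun z => Λ₀.mkQ u + z) (continuous_const_add _) (by
    rintro t _ ⟨x, hx, rfl⟩
    exact ⟨u + x, hf.vadd_mem_sublevel hu hx, map_add _ _ _⟩)

theorem translateTree_treePt (hf : K.IsPeriodicFilter f Λ) {u : EuclideanSpace ℝ (Fin d)}
    (hu : u ∈ Λ) {t : ℝ} {x : EuclideanSpace ℝ (Fin d)} (hx : x ∈ K.sublevel f t) :
    translateTree Λ₀ hf hu (treePt Λ₀ hx) = treePt Λ₀ (hf.vadd_mem_sublevel hu hx) :=
  rfl

theorem translateTree_neg (hf : K.IsPeriodicFilter f Λ) {u v : EuclideanSpace ℝ (Fin d)}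
    (hu : u ∈ Λ) (hv : v ∈ Λ) (huv : v + u = 0) (A : MergeTree (K.quotientSublevel f Λ₀)) :
    translateTree Λ₀ hf hv (translateTree Λ₀ hf hu A) = A := by
  obtain ⟨t, x, hx, rfl⟩ := exists_treePt A
  rw [translateTree_treePt, translateTree_treePt]
  congr 1
  rw [← add_assoc, huv, zero_add]

theorem projTree_translateTree (hf : K.IsPeriodicFilter f Λ) (hle : Λ₀ ≤ Λ)
    {u : EuclideanSpace ℝ (Fin d)} (hu : u ∈ Λ) (A : MergeTree (K.quotientSublevel f Λ₀)) :
    projTree K f hle (translateTree Λ₀ hf hu A) = projTree K f hle A := by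
  obtain ⟨t, x, hx, rfl⟩ := exists_treePt A
  rw [translateTree_treePt, projTree_treePt, projTree_treePt, eq_comm, treePt_eq_iff hf]
  exact ⟨u, hu, hf.vadd_comp hu hx⟩

/-- Transitivity of the action of Λ on the fibers of the projection. -/
theorem exists_translateTree_eq (hf : K.IsPeriodicFilter f Λ) (hle : Λ₀ ≤ Λ)
    {A B : MergeTree (K.quotientSublevel f Λ₀)} (h : projTree K f hle A = projTree K f hle B) :
    ∃ (u : EuclideanSpace ℝ (Fin d)) (hu : u ∈ Λ), translateTree Λ₀ hf hu A = B := by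
  obtain ⟨t, x, hx, rfl⟩ := exists_treePt A
  obtain ⟨s, y, hy, rfl⟩ := exists_treePt B
  rw [projTree_treePt, projTree_treePt] at h
  obtain rfl : t = s := congrArg MergeTree.height h
  obtain ⟨u, hu, hxy⟩ := (treePt_eq_iff hf hx hy).1 h
  refine ⟨u, hu, ?_⟩
  rw [translateTree_treePt, treePt_eq_iff (hf.mono hle)]
  exact ⟨0, Λ₀.zero_mem, by rw [zero_vadd, ← hxy, hf.vadd_comp hu hx]⟩

theorem preimage_projTree (hf : K.IsPeriodicFilter f Λ) (hle : Λ₀ ≤ Λ) {t : ℝ}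
    {x : EuclideanSpace ℝ (Fin d)} (hx : x ∈ K.sublevel f t) :
    projTree K f hle ⁻¹' {treePt Λ hx} =
      Set.range fun u : Λ => treePt Λ₀ (hf.vadd_mem_sublevel u.2 hx) := by
  ext A
  constructor
  · intro h
    obtain ⟨u, hu, rfl⟩ := exists_translateTree_eq hf hle (A := treePt Λ₀ hx) (B := A) h.symm
    exact ⟨⟨u, hu⟩, rfl⟩
  · rintro ⟨u, rfl⟩
    exact projTree_translateTree hf hle u.2 (treePt Λ₀ hx)

/-- The stabilizer in Λ of a point of the tree over Λ₀ is Λ₀ + Λ_Γ, where Γ is the image of the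
point. -/
theorem treePt_vadd_eq_iff (hf : K.IsPeriodicFilter f Λ) (hle : Λ₀ ≤ Λ) {t : ℝ}
    {x : EuclideanSpace ℝ (Fin d)} (hx : x ∈ K.sublevel f t) (u v : Λ) :
    treePt Λ₀ (hf.vadd_mem_sublevel u.2 hx) = treePt Λ₀ (hf.vadd_mem_sublevel v.2 hx) ↔
      (-u + v : EuclideanSpace ℝ (Fin d)) ∈
        Λ₀ ⊔ periodicityLattice Λ (Λ.mkQ '' K.comp f t x) := by
  rw [treePt_eq_iff (hf.mono hle), Submodule.mem_sup, ← hf.vadd_comp u.2 hx, ← hf.vadd_comp v.2 hx]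
  refine exists_congr fun w => and_congr_right fun hw => ?_
  constructor
  · intro h
    -- If `w` carries the `u`-translate to the `v`-translate, then `-w - u + v` fixes the component
    -- itself.
    refine ⟨-w + (-u + v), ?_, by abel⟩
    rw [hf.mem_periodicityLattice hx]
    refine ⟨Λ.add_mem (Λ.neg_mem (hle hw)) (Λ.add_mem (Λ.neg_mem u.2) v.2), ?_⟩
    rw [add_vadd, add_vadd, ← h, vadd_comm (-(u : EuclideanSpace ℝ (Fin d))) w, neg_vadd_vadd,
      neg_vadd_vadd]
  · rintro ⟨p, hp, hpw⟩
    obtain rfl : p = -w + (-u + v) := by rw [← hpw]; abel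
    have h := ((hf.mem_periodicityLattice hx).1 hp).2
    rw [add_vadd, add_vadd, neg_vadd_eq_iff, neg_vadd_eq_iff] at h
    rw [h, vadd_comm]

/-- Orbit-stabilizer count: the values of `F` correspond to the cosets of `H`. -/
theorem finite_range_and_ncard_range_eq_index {G α : Type*} [AddCommGroup G] (H : AddSubgroup G)
    (hH : H.index ≠ 0) (F : G → α) (hF : ∀ u v, F u = F v ↔ -u + v ∈ H) :
    (Set.range F).Finite ∧ (Set.range F).ncard = H.index := by
  have : H.FiniteIndex := ⟨hH⟩
  let F' : G ⧸ H → α := Quotient.lift (s := QuotientAddGroup.leftRel H) F fun u v h => (hF u v).2 (QuotientAddGroup.leftRel_apply.1 h)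
  have hF' : Function.Injective F' := by
    intro a b
    induction a using Quotient.ind
    induction b using Quotient.ind
    exact fun h => QuotientAddGroup.eq.2 ((hF _ _).1 h)
  have hr : Set.range F = Set.range F' :=
    (Set.range_quotient_lift (s := QuotientAddGroup.leftRel H) _).symm
  rw [hr]
  exact ⟨Set.finite_range F', by rw [← Nat.card_coe_set_eq, Nat.card_range_of_injective hF']; rfl⟩

/-! ### Fiber sizes, frequencies and translated subtrees -/

section Frequency

variable [DiscreteTopology Λ₀] [IsZLattice ℝ Λ₀] [DiscreteTopology Λ] [IsZLattice ℝ Λ]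

theorem finite_preimage_projTree (hf : K.IsPeriodicFilter f Λ) (hle : Λ₀ ≤ Λ) {t : ℝ}
    {x : EuclideanSpace ℝ (Fin d)} (hx : x ∈ K.sublevel f t) :
    (projTree K f hle ⁻¹' {treePt Λ hx}).Finite ∧
      (projTree K f hle ⁻¹' {treePt Λ hx}).ncard =
        (Λ₀ ⊔ periodicityLattice Λ (Λ.mkQ '' K.comp f t x)).toAddSubgroup.relIndex
          Λ.toAddSubgroup := by
  have hmul := relIndex_mul_relIndex_sup hle (periodicityLattice_le Λ (Λ.mkQ '' K.comp f t x))
  have hN := right_ne_zero_of_mul (hmul.trans_ne (relIndex_ne_zero_of_isZLattice hle))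
  rw [preimage_projTree hf hle hx]
  exact finite_range_and_ncard_range_eq_index (G := Λ.toAddSubgroup) _ hN _
    (treePt_vadd_eq_iff hf hle hx)

theorem shadowMonomial_component_eq_divNat (hf : K.IsPeriodicFilter f Λ) (hle : Λ₀ ≤ Λ)
    (A : MergeTree (K.quotientSublevel f Λ₀)) :
    shadowMonomial Λ₀ A.component =
      (shadowMonomial Λ (projTree K f hle A).component).divNat
        (projTree K f hle ⁻¹' {projTree K f hle A}).ncard := by
  obtain ⟨t, x, hx, rfl⟩ := exists_treePt A
  rw [projTree_treePt, component_treePt hf, component_treePt (hf.mono hle),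
    (finite_preimage_projTree hf hle hx).2]
  exact shadowMonomial_eq_divNat hf hle hx

/-- The frequency depends only on the projected point and the size of its fiber, and translation
changes neither. -/
theorem shadowMonomial_translateTree (hf : K.IsPeriodicFilter f Λ) (hle : Λ₀ ≤ Λ)
    {u : EuclideanSpace ℝ (Fin d)} (hu : u ∈ Λ) (A : MergeTree (K.quotientSublevel f Λ₀)) :
    shadowMonomial Λ₀ (translateTree Λ₀ hf hu A).component = shadowMonomial Λ₀ A.component := by
  rw [shadowMonomial_component_eq_divNat hf hle, projTree_translateTree,
    ← shadowMonomial_component_eq_divNat hf hle]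

/-- Translations by `u` and `-u` are mutually inverse and preserve heights, coverings and
frequencies, so they are 0-compatible. -/
theorem interleavingDist_subtree_translateTree (hf : K.IsPeriodicFilter f Λ) (hle : Λ₀ ≤ Λ)
    {u : EuclideanSpace ℝ (Fin d)} (hu : u ∈ Λ) (A : MergeTree (K.quotientSublevel f Λ₀)) :
    interleavingDist ((decoratedMergeTree K f Λ₀).subtree A)
      ((decoratedMergeTree K f Λ₀).subtree (translateTree Λ₀ hf hu A)) = 0 := by
  have hnu : -u ∈ Λ := Λ.neg_mem hu
  have hmap : ∀ {v} (hv : v ∈ Λ) {B C : MergeTree (K.quotientSublevel f Λ₀)}, B.Covers C →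
      (translateTree Λ₀ hf hv B).Covers (translateTree Λ₀ hf hv C) :=
    fun hv _ _ h => h.map quotientSublevel_mono _ _
  have hinv := translateTree_neg (Λ₀ := Λ₀) hf hu hnu (neg_add_cancel u)
  have hinv' := translateTree_neg (Λ₀ := Λ₀) hf hnu hu (add_neg_cancel u)
  have hcont : ∀ {v} (hv : v ∈ Λ), Continuous (translateTree Λ₀ hf hv) :=
    fun hv => MergeTree.continuous_map _ _ _
  have hheight : ∀ {v} (hv : v ∈ Λ) B, (translateTree Λ₀ hf hv B).height = B.height :=
    fun hv => MergeTree.height_map _ _ _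
  have hcov : ∀ {B C : MergeTree (K.quotientSublevel f Λ₀)}, B = C → B.Covers C :=
    fun h => h ▸ MergeTree.covers_refl _
  have hfreq : ∀ {v} (hv : v ∈ Λ) B, shadowMonomial Λ₀ (translateTree Λ₀ hf hv B).component ≤
      shadowMonomial Λ₀ B.component :=
    fun hv B => shadowMonomial_translateTree hf hle hv B ▸ Monomial.le_refl _
  have hback : ∀ {B}, (translateTree Λ₀ hf hu A).Covers B →
      A.Covers (translateTree Λ₀ hf hnu B) := fun {B} h => by
    have h' := hmap hnu h
    rwa [hinv] at h'
  exact interleavingDist_eq_zero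
    (φ := fun B => ⟨translateTree Λ₀ hf hu B.1, hmap hu B.2⟩)
    (ψ := fun B => ⟨translateTree Λ₀ hf hnu B.1, hback B.2⟩)
    { continuous_left := ((hcont hu).comp continuous_subtype_val).subtype_mk _
      continuous_right := ((hcont hnu).comp continuous_subtype_val).subtype_mk _
      height_left := fun B => (hheight hu B.1).trans (add_zero _).symm
      height_right := fun B => (hheight hnu B.1).trans (add_zero _).symm
      covers_left := fun B => hcov (hinv B.1)
      covers_right := fun B => hcov (hinv' B.1)
      freq_left := fun B => hfreq hu B.1
      freq_right := fun B => hfreq hnu B.1 }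

end Frequency

/-! ### Splintering by a sublattice -/

theorem projTree_image_covers (hf : K.IsPeriodicFilter f Λ) (hle : Λ₀ ≤ Λ)
    (A : MergeTree (K.quotientSublevel f Λ₀)) :
    projTree K f hle '' {B | A.Covers B} = {C | (projTree K f hle A).Covers C} := by
  refine Set.Subset.antisymm ?_ ?_
  · rintro _ ⟨B, hB, rfl⟩
    exact MergeTree.Covers.map quotientSublevel_mono _ _ hB
  · intro C hC
    obtain ⟨t, x, hx, rfl⟩ := exists_treePt A
    obtain ⟨s, y, hy, rfl⟩ := exists_treePt C
    obtain ⟨hst, hsub⟩ := hC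
    rw [height_treePt, projTree_treePt, height_treePt] at hst
    rw [projTree_treePt, component_treePt hf, component_treePt hf] at hsub
    -- The representative `y` may lie in another translate of the component of `x`; `z` is a
    -- Λ-translate of `y` inside that component, so that it is covered over Λ₀ too.
    obtain ⟨z, hz, hzy⟩ := hsub (Set.mem_image_of_mem _ (CellComplex.mem_comp hy))
    have hzs : z ∈ K.sublevel f s := by
      rw [← hf.mkQ_mem_quotientSublevel, hzy]
      exact hf.mkQ_mem_quotientSublevel.2 hy
    refine ⟨treePt Λ₀ hzs, ⟨hst, ?_⟩, ?_⟩
    · rw [component_treePt (hf.mono hle), component_treePt (hf.mono hle)]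
      exact Set.image_mono (CellComplex.comp_subset_comp hst hz)
    · rw [projTree_treePt]
      unfold treePt
      congr 3

theorem splinters_of_le [DiscreteTopology Λ₀] [IsZLattice ℝ Λ₀] [DiscreteTopology Λ]
    [IsZLattice ℝ Λ] (hf : K.IsPeriodicFilter f Λ) (hle : Λ₀ ≤ Λ) :
    Splinters (decoratedMergeTree K f Λ₀) (decoratedMergeTree K f Λ) := by
  refine ⟨projTree K f hle, MergeTree.continuous_map _ _ _, ?_, MergeTree.height_map _ _ _,
    fun C => ⟨?_, ?_⟩⟩
  · intro C
    obtain ⟨t, x, hx, rfl⟩ := exists_treePt C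
    exact ⟨treePt Λ₀ hx, rfl⟩
  · obtain ⟨t, x, hx, rfl⟩ := exists_treePt C
    exact (finite_preimage_projTree hf hle hx).1
  · rintro A rfl B hB
    replace hB : projTree K f hle B = projTree K f hle A := hB
    have hfreq : shadowMonomial Λ₀ (MergeTree.component B) = _ :=
      shadowMonomial_component_eq_divNat hf hle B
    rw [hB] at hfreq
    refine ⟨?_, projTree_image_covers hf hle A, ?_, ?_, hfreq⟩
    · obtain ⟨u, hu, rfl⟩ := exists_translateTree_eq hf hle hB.symm
      exact interleavingDist_subtree_translateTree hf hle hu A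
    · exact hB ▸ projTree_image_covers hf hle B
    · exact (shadowMonomial_component_eq_divNat hf hle A).trans hfreq.symm

end PeriodicMerge

open PeriodicMerge in
theorem mainTheorem1 {d : ℕ} (K : CellComplex d) (f : K.cells → ℝ)
    (Λ Λ' Λ'' : Submodule ℤ (EuclideanSpace ℝ (Fin d)))
    [DiscreteTopology Λ] [IsZLattice ℝ Λ]
    [DiscreteTopology Λ'] [IsZLattice ℝ Λ'] [DiscreteTopology Λ''] [IsZLattice ℝ Λ'']
    (hf : K.IsPeriodicFilter f Λ) (hΛ' : Λ' ≤ Λ) (hΛ'' : Λ'' ≤ Λ) :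
    Equivalent (perMTree K f Λ' (hf.mono hΛ')) (perMTree K f Λ'' (hf.mono hΛ'')) ∧
      interleavingPseudoDist (equivClass (perMTree K f Λ' (hf.mono hΛ')))
        (equivClass (perMTree K f Λ'' (hf.mono hΛ''))) = 0 := by
  have hequiv : Equivalent (perMTree K f Λ' (hf.mono hΛ')) (perMTree K f Λ'' (hf.mono hΛ'')) := by
    obtain ⟨_, _⟩ := isZLattice_inf hΛ' hΛ''
    exact ⟨perMTree K f (Λ' ⊓ Λ'') (hf.mono (inf_le_left.trans hΛ')),
      splinters_of_le (hf.mono hΛ') inf_le_left, splinters_of_le (hf.mono hΛ'') inf_le_right⟩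
  have hrefl : Equivalent (perMTree K f Λ' (hf.mono hΛ')) (perMTree K f Λ' (hf.mono hΛ')) :=
    ⟨perMTree K f Λ' (hf.mono hΛ'), splinters_of_le (hf.mono hΛ') le_rfl,
      splinters_of_le (hf.mono hΛ') le_rfl⟩
  refine ⟨hequiv, le_antisymm (sInf_le ?_) bot_le⟩
  -- A chain with one term (`k` counts the links, not the terms): the tree over `Λ'` lies in both
  -- classes and is at distance 0 from itself.
  refine ⟨0, fun _ => perMTree K f Λ' (hf.mono hΛ'), fun _ => perMTree K f Λ' (hf.mono hΛ'),
    hrefl, hequiv, fun i => i.elim0, ?_⟩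
  rw [Fin.sum_univ_one]
  exact (interleavingDist_self fun A => MergeTree.covers_refl A).symm
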